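/- Let $a<b$ and $m\ge 1$, let $w_0,\dots,w_{m-1}$ be real-valued continuous functions on $[a,b]$, and put $$(Lf)(t)=f^{(m)}(t)+\sum_{j=0}^{m-1}w_j(t)f^{(j)}(t).$$ Let $\mathcal H^m[a,b]$ be the real vector space of all $f:[a,b]\to\mathbb R$ such that $f,f',\dots,f^{(m-1)}$ exist on $[a,b]$ and are absolutely continuous and $\int_a^b (f^{(m)}(t))^2\,dt<\infty$ (derivatives at the end points are one-sided, and $f^{(m)}$ is defined almost everywhere). Let $u_1,\dots,u_m$ be a basis of the space of all $m$ times differentiable $\mu:[a,b]\to\mathbb R$ with $L\mu\equiv 0$ on $[a,b]$, let $W(t)$ be the Wronskian matrix, $[W(t)]_{ij}=u_i^{(j-1)}(t)$ for $1\le i,j\le m$, and for $f,g\in\mathcal H^m[a,b]$ put $$\langle f,g\rangle=\sum_{j=0}^{m-1}f^{(j)}(a)g^{(j)}(a)+\int_a^b (Lf)(t)(Lg)(t)\,dt .$$ Then $Lf\in L^2[a,b]$ for every $f\in\mathcal H^m[a,b]$, and $W(t)$ is invertible for every $t\in[a,b]$. Let $u_1^*(t),\dots,u_m^*(t)$ be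 the last row of $W(t)^{-1}$, and let $$G(t,v)=\sum_{i=1}^m u_i(t)u_i^*(v)\ \text{ if } v\le t,\qquad G(t,v)=0\ \text{ otherwise}.$$ Put $$\mathcal H_0=\{f\in\mathcal H^m[a,b]: Lf=0 \text{ almost everywhere}\},\qquad \mathcal H_1=\{f\in\mathcal H^m[a,b]: f^{(j)}(a)=0,\ 0\le j\le m-1\},$$ $$R_0(s,t)=\sum_{i,j=1}^m C_{ij}u_i(s)u_j(t),\quad C=(W(a)W(a)')^{-1},\qquad R_1(s,t)=\int_a^b G(s,v)G(t,v)\,dv .$$ Call a space $\mathcal H$ of real functions on $[a,b]$ with an inner product a reproducing kernel Hilbert space with reproducing kernel $R$ if it is complete, point evaluations are continuous on it, and $R(\cdot,t)\in\mathcal H$ and $\langle R(\cdot,t),f\rangle=f(t)$ for all $f\in\mathcal H$ and $t\in[a,b]$. Then the following hold. 1. For every $t\in[a,b]$, $G(t,\cdot)\in L^2[a,b]$, and $G$ is a Green's function for $L$: $f(t)=\int_a^b G(t,v)(Lf)(v)\,dv$ for every $f\in\mathcal H_1$ and $t\in[a,b]$. 2. $\langle\cdot,\cdot\rangle$ is an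 inner product on $\mathcal H^m[a,b]$, under which $\mathcal H^m[a,b]$ is a reproducing kernel Hilbert space with reproducing kernel $R_0+R_1$. 3. $\mathcal H_0=\operatorname{span}(u_1,\dots,u_m)$, $\mathcal H^m[a,b]$ is the direct sum of $\mathcal H_0$ and $\mathcal H_1$, and $\mathcal H_1$ is the orthogonal complement of $\mathcal H_0$ in $\mathcal H^m[a,b]$. 4. Under the same inner product, $\mathcal H_0$ and $\mathcal H_1$ are reproducing kernel Hilbert spaces with reproducing kernels $R_0$ and $R_1$ respectively. -/

import Mathlib

open Set MeasureTheory

noncomputable section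

namespace GreenRKHS

/-- The `k`-th derivative (one-sided at the end points) of a real function `f` on `[a, b]`.
It is a function on `ℝ` that vanishes outside `[a, b]`; its values on `[a, b]` depend on `f` only. -/
def D {a b : ℝ} (k : ℕ) (f : Icc a b → ℝ) : ℝ → ℝ :=
  iteratedDerivWithin k (Function.extend Subtype.val f 0) (Icc a b)

variable {a b : ℝ}

theorem D_zero_apply (f : Icc a b → ℝ) (x : Icc a b) : D 0 f x = f x := by
  simp only [D, iteratedDerivWithin_zero]
  exact Subtype.val_injective.extend_apply f 0 x

theorem D_succ (k : ℕ) (f : Icc a b → ℝ) (x : ℝ) :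
    D (k + 1) f x = derivWithin (D k f) (Icc a b) x := by
  simp only [D, iteratedDerivWithin_succ]

theorem D_of_notMem (k : ℕ) (f : Icc a b → ℝ) {x : ℝ} (hx : x ∉ Icc a b) : D k f x = 0 := by
  cases k with
  | zero =>
    simp only [D, iteratedDerivWithin_zero]
    rw [Function.extend_apply']
    · rfl
    · rintro ⟨y, rfl⟩
      exact hx y.2
  | succ k =>
    rw [D_succ]
    exact derivWithin_zero_of_notMem_closure (by rwa [isClosed_Icc.closure_eq])

/-- Membership in `H^m[a,b]`: the derivatives `f^{(j)}`, `j < m`, exist on `[a, b]` and are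
absolutely continuous, and the (almost everywhere defined) derivative `f^{(m)}` is in `L²`. -/
structure MemSobolev (m : ℕ) (f : Icc a b → ℝ) : Prop where
  differentiableOn : ∀ j, j + 1 < m → DifferentiableOn ℝ (D j f) (Icc a b)
  absolutelyContinuous : ∀ j, j < m → AbsolutelyContinuousOnInterval (D j f) a b
  memLp : MemLp (D m f) 2 (volume.restrict (Icc a b))

theorem D_lin_of_lt {m : ℕ} {f g : Icc a b → ℝ} (hf : MemSobolev m f) (hg : MemSobolev m g)
    (c d : ℝ) (j : ℕ) (hj : j < m ∨ j = 0) : D j (c • f + d • g) = c • D j f + d • D j g := by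
  induction j with
  | zero =>
    ext x
    by_cases hx : x ∈ Icc a b
    · have h := fun f : Icc a b → ℝ => D_zero_apply f ⟨x, hx⟩
      simp only at h
      simp [h]
    · simp [D_of_notMem _ _ hx]
  | succ k ih =>
    have hk : k + 1 < m := by omega
    ext x
    by_cases hx : x ∈ Icc a b
    · have h1 := (hf.differentiableOn k hk) x hx
      have h2 := (hg.differentiableOn k hk) x hx
      simp only [D_succ, Pi.add_apply, Pi.smul_apply, ih (Or.inl (by omega))]
      rw [derivWithin_add (h1.const_smul c) (h2.const_smul d), derivWithin_const_smul _ h1,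
        derivWithin_const_smul _ h2]
    · simp [D_of_notMem _ _ hx]

theorem D_lin_ae {m : ℕ} {f g : Icc a b → ℝ} (hf : MemSobolev m f) (hg : MemSobolev m g)
    (c d : ℝ) : D m (c • f + d • g) =ᵐ[volume.restrict (Icc a b)] c • D m f + d • D m g := by
  cases m with
  | zero => rw [D_lin_of_lt hf hg c d 0 (Or.inr rfl)]
  | succ k =>
    have h1 := (hf.absolutelyContinuous k (by omega)).ae_differentiableAt
    have h2 := (hg.absolutelyContinuous k (by omega)).ae_differentiableAt
    rw [Filter.EventuallyEq, ae_restrict_iff' measurableSet_Icc]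
    filter_upwards [h1, h2] with x h1 h2 hx
    have h1 := (h1 (Icc_subset_uIcc hx)).differentiableWithinAt (s := Icc a b)
    have h2 := (h2 (Icc_subset_uIcc hx)).differentiableWithinAt (s := Icc a b)
    simp only [D_succ, Pi.add_apply, Pi.smul_apply, D_lin_of_lt hf hg c d k (Or.inl (by omega))]
    rw [derivWithin_add (h1.const_smul c) (h2.const_smul d), derivWithin_const_smul _ h1,
      derivWithin_const_smul _ h2]

theorem D_zero_fun (k : ℕ) : D k (0 : Icc a b → ℝ) = 0 := by
  have h : Function.extend Subtype.val (0 : Icc a b → ℝ) (0 : ℝ → ℝ) = fun _ => 0 := by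
    ext x
    by_cases hx : x ∈ Icc a b
    · exact Subtype.val_injective.extend_apply (0 : Icc a b → ℝ) 0 ⟨x, hx⟩
    · rw [Function.extend_apply']
      · rfl
      · rintro ⟨y, rfl⟩
        exact hx y.2
  rw [D, h]
  ext x
  simp

theorem memSobolev_zero (m : ℕ) : MemSobolev m (0 : Icc a b → ℝ) where
  differentiableOn j _ := by rw [D_zero_fun]; exact differentiableOn_const 0
  absolutelyContinuous j _ := by
    rw [D_zero_fun]
    exact LipschitzOnWith.absolutelyContinuousOnInterval
      (K := 0) ((LipschitzWith.const (0 : ℝ)).lipschitzOnWith)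
  memLp := by rw [D_zero_fun]; exact MemLp.zero

theorem MemSobolev.lin {m : ℕ} {f g : Icc a b → ℝ} (hf : MemSobolev m f) (hg : MemSobolev m g)
    (c d : ℝ) : MemSobolev m (c • f + d • g) where
  differentiableOn j hj := by
    rw [D_lin_of_lt hf hg c d j (Or.inl (by omega))]
    exact ((hf.differentiableOn j hj).const_smul c).add ((hg.differentiableOn j hj).const_smul d)
  absolutelyContinuous j hj := by
    rw [D_lin_of_lt hf hg c d j (Or.inl hj)]
    exact ((hf.absolutelyContinuous j hj).const_smul c).add
      ((hg.absolutelyContinuous j hj).const_smul d)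
  memLp := (memLp_congr_ae (D_lin_ae hf hg c d)).2
    ((hf.memLp.const_smul c).add (hg.memLp.const_smul d))

variable (a b) in
/-- The real vector space `H^m[a,b]` of functions on `[a, b]`. -/
def Sob (m : ℕ) : Submodule ℝ (Icc a b → ℝ) where
  carrier := {f | MemSobolev m f}
  zero_mem' := memSobolev_zero m
  add_mem' {f g} hf hg := by simpa using MemSobolev.lin hf hg 1 1
  smul_mem' c f hf := by simpa using MemSobolev.lin hf hf c 0

/-- The differential operator `(L f)(t) = f^{(m)}(t) + ∑_{j < m} w_j(t) f^{(j)}(t)`. -/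
def L {m : ℕ} (w : Fin m → ℝ → ℝ) (f : Icc a b → ℝ) (t : ℝ) : ℝ :=
  D m f t + ∑ j : Fin m, w j t * D j f t

theorem L_lin_ae {m : ℕ} (w : Fin m → ℝ → ℝ) {f g : Icc a b → ℝ} (hf : MemSobolev m f)
    (hg : MemSobolev m g) (c d : ℝ) :
    L w (c • f + d • g) =ᵐ[volume.restrict (Icc a b)] c • L w f + d • L w g := by
  filter_upwards [D_lin_ae hf hg c d] with x hx
  have h : ∀ j : Fin m, D j (c • f + d • g) x = c * D j f x + d * D j g x := fun j => by
    rw [D_lin_of_lt hf hg c d j (Or.inl j.2)]; rfl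
  simp only [L, hx, h, Pi.add_apply, Pi.smul_apply, smul_eq_mul, mul_add, Finset.sum_add_distrib,
    Finset.mul_sum, mul_left_comm]
  ring

/-- `f` is a solution of `L f ≡ 0`: `f` has `m` derivatives at every point of `[a, b]`, and
`(L f)(t) = 0` for every `t` in `[a, b]`. -/
def IsSolution {m : ℕ} (w : Fin m → ℝ → ℝ) (f : Icc a b → ℝ) : Prop :=
  (∀ j, j < m → DifferentiableOn ℝ (D j f) (Icc a b)) ∧ ∀ t ∈ Icc a b, L w f t = 0

/-- `u_1, …, u_m` is a basis of the space of solutions of `L μ ≡ 0`. -/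
def IsSolutionBasis {m : ℕ} (w : Fin m → ℝ → ℝ) (u : Fin m → Icc a b → ℝ) : Prop :=
  LinearIndependent ℝ u ∧
    (Submodule.span ℝ (range u) : Set (Icc a b → ℝ)) = {f | IsSolution w f}

/-- `H₀`: the functions `f` in `H^m[a,b]` with `L f = 0` almost everywhere. -/
def H₀ {m : ℕ} (w : Fin m → ℝ → ℝ) : Submodule ℝ (Icc a b → ℝ) where
  carrier := {f | f ∈ Sob a b m ∧ ∀ᵐ t ∂(volume.restrict (Icc a b)), L w f t = 0}
  zero_mem' := ⟨(Sob a b m).zero_mem, by simp [L, D_zero_fun]⟩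
  add_mem' {f g} hf hg := by
    refine ⟨(Sob a b m).add_mem hf.1 hg.1, ?_⟩
    filter_upwards [L_lin_ae w hf.1 hg.1 1 1, hf.2, hg.2] with t h h1 h2
    simpa [h1, h2] using h
  smul_mem' c f hf := by
    refine ⟨(Sob a b m).smul_mem c hf.1, ?_⟩
    filter_upwards [L_lin_ae w hf.1 hf.1 c 0, hf.2] with t h h1
    simpa [h1] using h

variable (a b) in
/-- `H₁`: the functions `f` in `H^m[a,b]` with `f^{(j)}(a) = 0` for `j < m`. -/
def H₁ (m : ℕ) : Submodule ℝ (Icc a b → ℝ) where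
  carrier := {f | f ∈ Sob a b m ∧ ∀ j, j < m → D j f a = 0}
  zero_mem' := ⟨(Sob a b m).zero_mem, by simp [D_zero_fun]⟩
  add_mem' {f g} hf hg := by
    refine ⟨(Sob a b m).add_mem hf.1 hg.1, fun j hj => ?_⟩
    have h := congrFun (D_lin_of_lt hf.1 hg.1 1 1 j (Or.inl hj)) a
    simpa [hf.2 j hj, hg.2 j hj] using h
  smul_mem' c f hf := by
    refine ⟨(Sob a b m).smul_mem c hf.1, fun j hj => ?_⟩
    have h := congrFun (D_lin_of_lt hf.1 hf.1 c 0 j (Or.inl hj)) a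
    simpa [hf.2 j hj] using h

/-- `⟨f, g⟩ = ∑_{j < m} f^{(j)}(a) g^{(j)}(a) + ∫_a^b (L f)(t) (L g)(t) dt`. -/
def ip {m : ℕ} (w : Fin m → ℝ → ℝ) (f g : Icc a b → ℝ) : ℝ :=
  ∑ j : Fin m, D j f a * D j g a + ∫ t in a..b, L w f t * L w g t

/-- The Wronskian matrix, `W(t)_{ij} = u_i^{(j-1)}(t)` for `1 ≤ i, j ≤ m`
(here the indices start at `0`). -/
def W {m : ℕ} (u : Fin m → Icc a b → ℝ) (t : ℝ) : Matrix (Fin m) (Fin m) ℝ :=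
  Matrix.of fun i j => D j (u i) t

/-- `u_i^*(t)`: the `i`-th entry of the last row of `W(t)⁻¹`. -/
def uStar {m : ℕ} (hm : 0 < m) (u : Fin m → Icc a b → ℝ) (i : Fin m) (t : ℝ) : ℝ :=
  (W u t)⁻¹ ⟨m - 1, Nat.sub_lt hm Nat.one_pos⟩ i

/-- `G(t, v) = ∑_i u_i(t) u_i^*(v)` for `v ≤ t`, and `0` otherwise. -/
def G {m : ℕ} (hm : 0 < m) (u : Fin m → Icc a b → ℝ) (t : Icc a b) (v : ℝ) : ℝ :=
  if v ≤ t then ∑ i : Fin m, u i t * uStar hm u i v else 0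

/-- `R₀(s, t) = ∑_{i,j} C_{ij} u_i(s) u_j(t)` with `C = (W(a) W(a)')⁻¹`. -/
def R₀ {m : ℕ} (u : Fin m → Icc a b → ℝ) (s t : Icc a b) : ℝ :=
  ∑ i : Fin m, ∑ j : Fin m, (W u a * (W u a).transpose)⁻¹ i j * u i s * u j t

/-- `R₁(s, t) = ∫_a^b G(s, v) G(t, v) dv`. -/
def R₁ {m : ℕ} (hm : 0 < m) (u : Fin m → Icc a b → ℝ) (s t : Icc a b) : ℝ :=
  ∫ v in a..b, G hm u s v * G hm u t v

/-- `K` is a Green's function for `L`: `f(t) = ∫_a^b K(t, v) (L f)(v) dv` (with an integrable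
integrand) for every `f` in `H^m[a,b]` such that `f^{(j)}(a) = 0` for `j < m`. -/
def IsGreenFunction {m : ℕ} (w : Fin m → ℝ → ℝ) (K : Icc a b → ℝ → ℝ) : Prop :=
  ∀ f ∈ H₁ a b m, ∀ t : Icc a b,
    IntervalIntegrable (fun v => K t v * L w f v) volume a b ∧
      f t = ∫ v in a..b, K t v * L w f v

/-- The inner product space `E`, whose elements are regarded through `ι` as real functions
on `X`, is a reproducing kernel Hilbert space with reproducing kernel `R`: it is complete, the
map to functions is linear, injective and has continuous point evaluations, and
`R(·, t)` is an element of `E` with `⟨R(·, t), f⟩ = f(t)` for all `f`. -/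
def HasKernel {E X : Type*} [NormedAddCommGroup E] [InnerProductSpace ℝ E] (ι : E → X → ℝ)
    (R : X → X → ℝ) : Prop :=
  ∃ (_ : CompleteSpace E) (_ : RKHS ℝ E X ℝ),
    (∀ f : E, RKHS.coeCLM ℝ f = ι f) ∧
    (∀ s t, RKHS.kernel E s t 1 = R s t) ∧
    ∀ t, ∃ r : E, (∀ s, ι r s = R s t) ∧ ∀ f : E, inner ℝ r f = ι f t

/-- The space of functions `H` is a reproducing kernel Hilbert space with reproducing kernel `R`
under the form `B`: the restriction of `B` to `H` is an inner product, and `H` with this inner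
product and the induced norm is a reproducing kernel Hilbert space with kernel `R`. -/
def IsRKHSWith {X : Type*} (H : Submodule ℝ (X → ℝ)) (B : (X → ℝ) → (X → ℝ) → ℝ)
    (R : X → X → ℝ) : Prop :=
  ∃ core : InnerProductSpace.Core ℝ H,
    (∀ f g : H, core.inner f g = B f g) ∧
    letI : NormedAddCommGroup H := core.toNormedAddCommGroup
    letI : InnerProductSpace ℝ H := InnerProductSpace.ofCore core.toCore
    HasKernel (fun f : H => (f : X → ℝ)) R

end GreenRKHS

end

open GreenRKHS

/-!
The theorem is variation of parameters read as an isometry.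

By uniqueness for the first order system equivalent to `L f = 0`, a solution whose first `m`
derivatives vanish at one point of `[a, b]` is zero (`IsSolution.eq_zero`), so the Wronskian matrix
is invertible at every point (`IsSolutionBasis.isUnit_W`). If `f` is a Sobolev function with
`L f = 0` almost everywhere, then `f^{(m-1)}` is the integral of a continuous function, so `f` is a
solution in the classical sense (`isSolution_of_ae`). Hence `H₀` is the span of the `u_i`, and a
Sobolev function is determined by its first `m` derivatives at `a` together with the class of `L f`
in `L²` (`eq_of_D_eq_of_L_ae_eq`).

Conversely, for `c ∈ ℝᵐ` and `h ∈ L²` the function `∑ᵢ (cᵢ + ∫ₐᵗ uᵢ* h) uᵢ(t)` is a Sobolev function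
with `L f = h` almost everywhere and initial derivatives `∑ᵢ cᵢ uᵢ^{(j)}(a)`: the `uᵢ*` are the last
row of `W⁻¹`, so the extra terms in the successive derivatives cancel up to order `m - 1`
(`IsSolutionBasis.derivWithin_variationD_ae`, `IsSolutionBasis.L_variation_ae`). With `c = 0` this
function is `∫ G(t, v) h(v) dv`, which gives the Green's function property, and with
`h = G(t, ·)` it is `R₁(·, t)`.

Therefore `f ↦ ((f^{(j)}(a))_j, L f)` is a linear bijection of `H^m` onto `ℝᵐ × L²` which carries
`⟨·, ·⟩` to the standard inner product and maps `H₀` and `H₁` onto the two factors. Completeness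
follows, and the reproducing property is the variation of parameters formula
`f(t) = ∑ⱼ R₀(·, t)^{(j)}(a) f^{(j)}(a) + ∫ G(t, v) (L f)(v) dv`
(`IsSolutionBasis.sum_add_integral_eq`).
-/

noncomputable section

namespace GreenRKHS

variable {a b : ℝ}

/-! ### Continuous, absolutely continuous and square-integrable functions on an interval -/

theorem _root_.ContinuousOn.memLp_restrict_Icc {f : ℝ → ℝ} (hf : ContinuousOn f (Icc a b))
    (p : ENNReal) : MemLp f p (volume.restrict (Icc a b)) := by
  obtain ⟨C, hC⟩ := isCompact_Icc.exists_bound_of_continuousOn hf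
  refine MemLp.of_bound (hf.aestronglyMeasurable measurableSet_Icc) C ?_
  exact (ae_restrict_iff' measurableSet_Icc).2 (Filter.Eventually.of_forall hC)

theorem _root_.MeasureTheory.Integrable.intervalIntegrable_of_Icc (hab : a ≤ b) {f : ℝ → ℝ}
    (hf : Integrable f (volume.restrict (Icc a b))) : IntervalIntegrable f volume a b :=
  (intervalIntegrable_iff_integrableOn_Icc_of_le hab).2 hf

theorem intervalIntegral_eq_setIntegral_Icc (hab : a ≤ b) (f : ℝ → ℝ) :
    ∫ t in a..b, f t = ∫ t in Icc a b, f t := by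
  rw [intervalIntegral.integral_of_le hab, integral_Icc_eq_integral_Ioc]

theorem _root_.IntervalIntegrable.mono_left_Icc {f : ℝ → ℝ} (hf : IntervalIntegrable f volume a b)
    {x : ℝ} (hx : x ∈ Icc a b) : IntervalIntegrable f volume a x :=
  hf.mono_set (uIcc_subset_uIcc left_mem_uIcc (Icc_subset_uIcc hx))

theorem _root_.AbsolutelyContinuousOnInterval.congr_Icc (hab : a ≤ b) {f g : ℝ → ℝ}
    (hf : AbsolutelyContinuousOnInterval f a b) (h : EqOn f g (Icc a b)) :
    AbsolutelyContinuousOnInterval g a b := by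
  rw [absolutelyContinuousOnInterval_iff] at hf ⊢
  intro ε hε
  obtain ⟨δ, hδ, H⟩ := hf ε hε
  refine ⟨δ, hδ, fun E hE hl => ?_⟩
  refine lt_of_eq_of_lt (Finset.sum_congr rfl fun i hi => ?_) (H E hE hl)
  have := hE.1 i hi
  rw [uIcc_of_le hab] at this
  rw [h this.1, h this.2]

theorem _root_.AbsolutelyContinuousOnInterval.fun_sum {ι : Type*} {s : Finset ι}
    {f : ι → ℝ → ℝ} (hf : ∀ i ∈ s, AbsolutelyContinuousOnInterval (f i) a b) :
    AbsolutelyContinuousOnInterval (fun x => ∑ i ∈ s, f i x) a b := by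
  classical
  induction s using Finset.induction_on with
  | empty =>
    simpa using LipschitzOnWith.absolutelyContinuousOnInterval
      (K := 0) ((LipschitzWith.const (0 : ℝ)).lipschitzOnWith (s := uIcc a b))
  | insert i s hi ih =>
    simp only [Finset.sum_insert hi]
    exact (hf i (Finset.mem_insert_self i s)).fun_add
      (ih fun j hj => hf j (Finset.mem_insert_of_mem hj))

/-- The fundamental theorem of calculus for absolutely continuous functions, phrased with the
one-sided derivative. -/
theorem _root_.AbsolutelyContinuousOnInterval.eq_add_integral (hab : a < b) {f f' : ℝ → ℝ}
    (hf : AbsolutelyContinuousOnInterval f a b)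
    (hf' : derivWithin f (Icc a b) =ᵐ[volume.restrict (Icc a b)] f') {x : ℝ} (hx : x ∈ Icc a b) :
    f x = f a + ∫ t in a..x, f' t := by
  have hac := hf.mono (uIcc_subset_uIcc left_mem_uIcc (Icc_subset_uIcc hx))
  have h : ∫ t in a..x, f' t = ∫ t in a..x, deriv f t := by
    refine intervalIntegral.integral_congr_ae ?_
    have hf' := (ae_restrict_iff' measurableSet_Icc).1 hf'
    filter_upwards [hf', hf.ae_differentiableAt] with t h1 h2 ht
    rw [uIoc_of_le hx.1] at ht
    have ht : t ∈ Icc a b := ⟨ht.1.le, ht.2.trans hx.2⟩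
    rw [← h1 ht, (h2 (Icc_subset_uIcc ht)).derivWithin (uniqueDiffOn_Icc hab t ht)]
  rw [h, hac.integral_deriv_eq_sub]
  ring

theorem absolutelyContinuousOnInterval_of_hasDerivWithinAt (hab : a ≤ b) {f f' : ℝ → ℝ}
    (hf : ∀ x ∈ Icc a b, HasDerivWithinAt f (f' x) (Icc a b) x) (hf' : ContinuousOn f' (Icc a b)) :
    AbsolutelyContinuousOnInterval f a b := by
  obtain ⟨C, hC⟩ := isCompact_Icc.exists_bound_of_continuousOn hf'
  refine LipschitzOnWith.absolutelyContinuousOnInterval (K := C.toNNReal) ?_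
  rw [uIcc_of_le hab]
  refine (convex_Icc a b).lipschitzOnWith_of_nnnorm_hasDerivWithin_le hf fun x hx => ?_
  rw [← NNReal.coe_le_coe, coe_nnnorm]
  exact (hC x hx).trans (Real.le_coe_toNNReal C)

theorem hasDerivWithinAt_integral_Icc (hab : a ≤ b) {f : ℝ → ℝ} (hf : ContinuousOn f (Icc a b))
    {x : ℝ} (hx : x ∈ Icc a b) :
    HasDerivWithinAt (fun t => ∫ v in a..t, f v) (f x) (Icc a b) x := by
  have : Fact (x ∈ Icc a b) := ⟨hx⟩
  refine intervalIntegral.integral_hasDerivWithinAt_right ?_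
    (t := Icc a b) ?_ (hf x hx)
  · exact ((hf.memLp_restrict_Icc 1).integrable le_rfl).intervalIntegrable_of_Icc hab
      |>.mono_left_Icc hx
  · exact hf.stronglyMeasurableAtFilter_nhdsWithin measurableSet_Icc x

/-! ### Derivatives of functions on the interval -/

theorem hasDerivWithinAt_D {f : Icc a b → ℝ} {j : ℕ} (h : DifferentiableOn ℝ (D j f) (Icc a b))
    {x : ℝ} (hx : x ∈ Icc a b) : HasDerivWithinAt (D j f) (D (j + 1) f x) (Icc a b) x := by
  rw [D_succ]
  exact (h x hx).hasDerivWithinAt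

/-- A chain of functions, each the derivative of the previous one, that starts with `f` consists
of the iterated derivatives of `f`. -/
theorem D_eqOn_of_hasDerivWithinAt (hab : a < b) {f : Icc a b → ℝ} {g : ℕ → ℝ → ℝ} {n : ℕ}
    (h0 : ∀ x : Icc a b, f x = g 0 x)
    (hg : ∀ j < n, ∀ x ∈ Icc a b, HasDerivWithinAt (g j) (g (j + 1) x) (Icc a b) x)
    {j : ℕ} (hj : j ≤ n) : EqOn (D j f) (g j) (Icc a b) := by
  induction j with
  | zero =>
    intro x hx
    exact (D_zero_apply f ⟨x, hx⟩).trans (h0 ⟨x, hx⟩)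
  | succ k ih =>
    intro x hx
    have ih := ih (by omega)
    rw [D_succ, derivWithin_congr ih (ih hx)]
    exact (hg k (by omega) x hx).derivWithin (uniqueDiffOn_Icc hab x hx)

theorem MemSobolev.continuousOn_D (hab : a ≤ b) {m : ℕ} {f : Icc a b → ℝ} (hf : MemSobolev m f)
    {j : ℕ} (hj : j < m) : ContinuousOn (D j f) (Icc a b) := by
  simpa [uIcc_of_le hab] using (hf.absolutelyContinuous j hj).continuousOn

theorem D_lin_sum_of_lt {m : ℕ} {ι : Type*} {u : ι → Icc a b → ℝ} (s : Finset ι)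
    (hu : ∀ i, MemSobolev m (u i)) (c : ι → ℝ) {j : ℕ} (hj : j < m) (x : ℝ) :
    D j (∑ i ∈ s, c i • u i) x = ∑ i ∈ s, c i * D j (u i) x := by
  classical
  induction s using Finset.induction_on with
  | empty => simp [D_zero_fun]
  | insert i s hi ih =>
    have hs : MemSobolev m (∑ i ∈ s, c i • u i) :=
      (Sob a b m).sum_mem fun i _ => (Sob a b m).smul_mem _ (hu i)
    have h := congrFun (D_lin_of_lt (hu i) hs (c i) 1 j (Or.inl hj)) x
    simp only [one_smul, Pi.add_apply, Pi.smul_apply, smul_eq_mul] at h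
    rw [Finset.sum_insert hi, Finset.sum_insert hi, h, ih]

/-! ### Solutions of the homogeneous equation -/

section Solution

variable {m : ℕ} {w : Fin m → ℝ → ℝ}

theorem L_memLp (hab : a ≤ b) (hw : ∀ j, ContinuousOn (w j) (Icc a b)) {f : Icc a b → ℝ}
    (hf : MemSobolev m f) : MemLp (L w f) 2 (volume.restrict (Icc a b)) := by
  refine MemLp.add (f := D m f) hf.memLp ?_
  refine ContinuousOn.memLp_restrict_Icc ?_ 2
  exact continuousOn_finsetSum _ fun j _ => (hw j).mul (hf.continuousOn_D hab j.2)

theorem IsSolution.continuousOn_D {f : Icc a b → ℝ} (hf : IsSolution w f)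
    (hw : ∀ j, ContinuousOn (w j) (Icc a b)) {j : ℕ} (hj : j ≤ m) :
    ContinuousOn (D j f) (Icc a b) := by
  rcases hj.lt_or_eq with hj | rfl
  · exact (hf.1 j hj).continuousOn
  · have h : ContinuousOn (fun t => -∑ i : Fin j, w i t * D i f t) (Icc a b) :=
      (continuousOn_finsetSum _ fun i _ => (hw i).mul (hf.1 i i.2).continuousOn).neg
    exact h.congr fun t ht => eq_neg_of_add_eq_zero_left (hf.2 t ht)

theorem IsSolution.memSobolev (hab : a ≤ b) {f : Icc a b → ℝ} (hf : IsSolution w f)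
    (hw : ∀ j, ContinuousOn (w j) (Icc a b)) : MemSobolev m f where
  differentiableOn j hj := hf.1 j (by omega)
  absolutelyContinuous j hj := absolutelyContinuousOnInterval_of_hasDerivWithinAt hab
    (fun _ hx => hasDerivWithinAt_D (hf.1 j hj) hx) (hf.continuousOn_D hw hj)
  memLp := (hf.continuousOn_D hw le_rfl).memLp_restrict_Icc 2

/-- A Sobolev function that solves the equation almost everywhere solves it everywhere: its
derivative of order `m - 1` is the integral of a continuous function. -/
theorem isSolution_of_ae (hab : a < b) (hm : 0 < m) (hw : ∀ j, ContinuousOn (w j) (Icc a b))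
    {f : Icc a b → ℝ} (hf : MemSobolev m f)
    (h : ∀ᵐ t ∂(volume.restrict (Icc a b)), L w f t = 0) : IsSolution w f := by
  obtain ⟨n, rfl⟩ : ∃ n, m = n + 1 := ⟨m - 1, by omega⟩
  set p : ℝ → ℝ := fun t => -∑ j : Fin (n + 1), w j t * D j f t with hp
  have hpc : ContinuousOn p (Icc a b) :=
    (continuousOn_finsetSum _ fun i _ => (hw i).mul (hf.continuousOn_D hab.le i.2)).neg
  have hd : derivWithin (D n f) (Icc a b) =ᵐ[volume.restrict (Icc a b)] p := by
    filter_upwards [h] with t ht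
    rw [← D_succ]
    exact eq_neg_of_add_eq_zero_left ht
  have hder : ∀ x ∈ Icc a b, HasDerivWithinAt (D n f) (p x) (Icc a b) x := by
    intro x hx
    refine ((hasDerivWithinAt_integral_Icc hab.le hpc hx).const_add (D n f a)).congr
      (fun y hy => ?_) ?_
    · exact (hf.absolutelyContinuous n n.lt_succ_self).eq_add_integral hab hd hy
    · exact (hf.absolutelyContinuous n n.lt_succ_self).eq_add_integral hab hd hx
  refine ⟨fun j hj => ?_, fun t ht => ?_⟩
  · rcases Nat.lt_or_ge (j + 1) (n + 1) with h | h
    · exact hf.differentiableOn j h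
    · obtain rfl : j = n := by omega
      exact fun x hx => (hder x hx).differentiableWithinAt
  · rw [L, D_succ, (hder t ht).derivWithin (uniqueDiffOn_Icc hab t ht)]
    exact neg_add_cancel _

theorem mem_H₀_iff_isSolution (hab : a < b) (hm : 0 < m)
    (hw : ∀ j, ContinuousOn (w j) (Icc a b)) {f : Icc a b → ℝ} :
    f ∈ H₀ w ↔ IsSolution w f := by
  refine ⟨fun h => isSolution_of_ae hab hm hw h.1 h.2, fun h => ⟨h.memSobolev hab.le hw, ?_⟩⟩
  exact (ae_restrict_iff' measurableSet_Icc).2 (Filter.Eventually.of_forall h.2)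

/-- The right-hand side of the first order system `x' = companion w t x` equivalent to
`L f = 0`, where `x_j` stands for `f^{(j)}`. -/
def companion (w : Fin m → ℝ → ℝ) (t : ℝ) (x : Fin m → ℝ) (j : Fin m) : ℝ :=
  if h : (j : ℕ) + 1 < m then x ⟨j + 1, h⟩ else -∑ i, w i t * x i

theorem companion_zero (t : ℝ) : companion w t 0 = 0 := by
  ext j
  simp [companion]

theorem exists_lipschitz_companion (hw : ∀ j, ContinuousOn (w j) (Icc a b)) :
    ∃ K, ∀ t ∈ Icc a b, LipschitzOnWith K (companion w t) univ := by
  choose C hC using fun j => isCompact_Icc.exists_bound_of_continuousOn (hw j)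
  refine ⟨(1 + ∑ i, |C i|).toNNReal, fun t ht => ?_⟩
  have hs : 0 ≤ ∑ i, |C i| := Finset.sum_nonneg fun i _ => abs_nonneg _
  refine LipschitzOnWith.of_dist_le_mul fun x _ y _ => ?_
  rw [Real.coe_toNNReal _ (by positivity)]
  refine (dist_pi_le_iff (by positivity)).2 fun j => ?_
  by_cases h : (j : ℕ) + 1 < m
  · simp only [companion, h, dite_true]
    refine (dist_le_pi_dist x y _).trans ?_
    nlinarith [dist_nonneg (x := x) (y := y)]
  · simp only [companion, h, dite_false]
    rw [dist_neg_neg]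
    refine (dist_sum_sum_le_of_le _ (f := fun i => w i t * x i) (a := fun i => w i t * y i)
      (d := fun i => |C i| * dist x y) fun i _ => ?_).trans ?_
    · rw [Real.dist_eq, ← mul_sub, abs_mul, ← Real.dist_eq]
      exact mul_le_mul ((hC i t ht).trans (le_abs_self _)) (dist_le_pi_dist x y i)
        dist_nonneg (abs_nonneg _)
    · rw [← Finset.sum_mul]
      nlinarith [dist_nonneg (x := x) (y := y)]

theorem IsSolution.hasDerivWithinAt_jet {f : Icc a b → ℝ} (hf : IsSolution w f) {t : ℝ}
    (ht : t ∈ Icc a b) :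
    HasDerivWithinAt (fun s (j : Fin m) => D j f s) (companion w t fun j => D j f t)
      (Icc a b) t := by
  refine hasDerivWithinAt_pi.2 fun j => ?_
  have h := hasDerivWithinAt_D (hf.1 j j.2) ht
  by_cases hj : (j : ℕ) + 1 < m
  · simpa only [companion, hj, dite_true] using h
  · have e : (j : ℕ) + 1 = m := by have := j.2; omega
    simp only [companion, hj, dite_false]
    rw [e, eq_neg_of_add_eq_zero_left (hf.2 t ht)] at h
    exact h

/-- A solution of the homogeneous equation whose first `m` derivatives vanish at some point is
zero. -/
theorem IsSolution.eq_zero (hm : 0 < m) (hw : ∀ j, ContinuousOn (w j) (Icc a b))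
    {f : Icc a b → ℝ} (hf : IsSolution w f) {t₀ : ℝ} (ht₀ : t₀ ∈ Icc a b)
    (h0 : ∀ j < m, D j f t₀ = 0) : f = 0 := by
  obtain ⟨K, hK⟩ := exists_lipschitz_companion hw
  have hc : ContinuousOn (fun s (j : Fin m) => D j f s) (Icc a b) :=
    continuousOn_pi.2 fun j => (hf.1 j j.2).continuousOn
  have hz : (fun j : Fin m => D j f t₀) = 0 := funext fun j => h0 j j.2
  have key : ∀ t ∈ Icc a b, (fun j : Fin m => D j f t) = 0 := by
    intro t ht
    rcases le_total t₀ t with h | h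
    · have hsub : Icc t₀ b ⊆ Icc a b := Icc_subset_Icc_left ht₀.1
      have hsub' : Ico t₀ b ⊆ Icc a b := Ico_subset_Icc_self.trans hsub
      refine ODE_solution_unique_of_mem_Icc_right (v := companion w) (s := fun _ => univ)
        (K := K) (g := fun _ => 0) (fun s hs => hK s (hsub' hs)) (hc.mono hsub)
        (fun s hs => (hf.hasDerivWithinAt_jet (hsub' hs)).mono_of_mem_nhdsWithin ?_)
        (fun _ _ => trivial) continuousOn_const (fun s _ => ?_) (fun _ _ => trivial) hz ⟨h, ht.2⟩
      · exact Filter.mem_of_superset (Icc_mem_nhdsGE hs.2) (Icc_subset_Icc_left (hsub' hs).1)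
      · simpa only [companion_zero] using hasDerivWithinAt_const s (Ici s) (0 : Fin m → ℝ)
    · have hsub : Icc a t₀ ⊆ Icc a b := Icc_subset_Icc_right ht₀.2
      have hsub' : Ioc a t₀ ⊆ Icc a b := Ioc_subset_Icc_self.trans hsub
      refine ODE_solution_unique_of_mem_Icc_left (v := companion w) (s := fun _ => univ)
        (K := K) (g := fun _ => 0) (fun s hs => hK s (hsub' hs)) (hc.mono hsub)
        (fun s hs => (hf.hasDerivWithinAt_jet (hsub' hs)).mono_of_mem_nhdsWithin ?_)
        (fun _ _ => trivial) continuousOn_const (fun s _ => ?_) (fun _ _ => trivial) hz ⟨ht.1, h⟩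
      · exact Filter.mem_of_superset (Icc_mem_nhdsLE hs.1) (Icc_subset_Icc_right (hsub' hs).2)
      · simpa only [companion_zero] using hasDerivWithinAt_const s (Iic s) (0 : Fin m → ℝ)
  ext x
  rw [← D_zero_apply f x]
  exact congrFun (key x x.2) ⟨0, hm⟩

/-- Sobolev functions are determined by their first `m` derivatives at `a` and by `L f`. -/
theorem eq_of_D_eq_of_L_ae_eq (hab : a < b) (hm : 0 < m)
    (hw : ∀ j, ContinuousOn (w j) (Icc a b)) {f g : Icc a b → ℝ}
    (hf : MemSobolev m f) (hg : MemSobolev m g) (hD : ∀ j < m, D j f a = D j g a)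
    (hL : L w f =ᵐ[volume.restrict (Icc a b)] L w g) : f = g := by
  have e : (1 : ℝ) • f + (-1 : ℝ) • g = f - g := by simp [sub_eq_add_neg]
  have hs := hf.lin hg 1 (-1)
  have h1 : IsSolution w (f - g) := by
    rw [← e]
    refine isSolution_of_ae hab hm hw hs ?_
    filter_upwards [L_lin_ae w hf hg 1 (-1), hL] with t h1 h2
    rw [h1]
    simp [h2]
  refine sub_eq_zero.1 (h1.eq_zero hm hw (left_mem_Icc.2 hab.le) fun j hj => ?_)
  rw [← e, D_lin_of_lt hf hg _ _ j (Or.inl hj)]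
  simp [hD j hj]

end Solution

variable {m : ℕ} {w : Fin m → ℝ → ℝ} {u : Fin m → Icc a b → ℝ}

/-! ### The Wronskian matrix of a fundamental system -/

theorem IsSolutionBasis.isSolution (hu : IsSolutionBasis w u) (i : Fin m) :
    IsSolution w (u i) := by
  have h : u i ∈ (Submodule.span ℝ (range u) : Set (Icc a b → ℝ)) :=
    Submodule.subset_span (mem_range_self i)
  rwa [hu.2] at h

theorem IsSolutionBasis.isSolution_sum (hu : IsSolutionBasis w u) (c : Fin m → ℝ) :
    IsSolution w (∑ i, c i • u i) := by
  have h : ∑ i, c i • u i ∈ (Submodule.span ℝ (range u) : Set (Icc a b → ℝ)) :=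
    Submodule.sum_mem _ fun i _ =>
      Submodule.smul_mem _ _ (Submodule.subset_span (mem_range_self i))
  rwa [hu.2] at h

theorem IsSolutionBasis.isUnit_W (hab : a ≤ b) (hm : 0 < m)
    (hw : ∀ j, ContinuousOn (w j) (Icc a b)) (hu : IsSolutionBasis w u) {t : ℝ}
    (ht : t ∈ Icc a b) : IsUnit (W u t) := by
  rw [Matrix.isUnit_iff_isUnit_det, isUnit_iff_ne_zero]
  intro hdet
  obtain ⟨c, hc, hcW⟩ := Matrix.exists_vecMul_eq_zero_iff.2 hdet
  refine hc (funext fun i => ?_)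
  refine Fintype.linearIndependent_iff.1 hu.1 c
    ((hu.isSolution_sum c).eq_zero hm hw ht fun j hj => ?_) i
  rw [D_lin_sum_of_lt _ (fun i => (hu.isSolution i).memSobolev hab hw) c hj]
  exact congrFun hcW ⟨j, hj⟩

theorem IsSolutionBasis.continuousOn_uStar (hab : a ≤ b) (hm : 0 < m)
    (hw : ∀ j, ContinuousOn (w j) (Icc a b)) (hu : IsSolutionBasis w u) (i : Fin m) :
    ContinuousOn (uStar hm u i) (Icc a b) := by
  have hW : ContinuousOn (W u) (Icc a b) :=
    continuousOn_pi.2 fun i => continuousOn_pi.2 fun j => (hu.isSolution i).continuousOn_D hw j.2.le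
  intro t ht
  have hdet : (W u t).det ≠ 0 :=
    ((Matrix.isUnit_iff_isUnit_det _).1 (hu.isUnit_W hab hm hw ht)).ne_zero
  have h1 : ContinuousWithinAt (fun s => (W u s).det) (Icc a b) t :=
    (Continuous.matrix_det continuous_id).continuousAt.comp_continuousWithinAt (hW t ht)
  have h2 : ContinuousWithinAt (fun s => (W u s).adjugate) (Icc a b) t :=
    (Continuous.matrix_adjugate continuous_id).continuousAt.comp_continuousWithinAt (hW t ht)
  have h3 : ContinuousWithinAt
      (fun s => (W u s).adjugate ⟨m - 1, Nat.sub_lt hm Nat.one_pos⟩ i) (Icc a b) t :=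
    (continuous_apply_apply (⟨m - 1, Nat.sub_lt hm Nat.one_pos⟩ : Fin m) i
      |>.continuousAt).comp_continuousWithinAt h2
  refine ((h1.inv₀ hdet).mul h3).congr (fun s _ => ?_) ?_ <;>
  simp [uStar, Matrix.inv_def, Ring.inverse_eq_inv']

/-- The last row of `W⁻¹ W = 1`. -/
theorem IsSolutionBasis.sum_uStar_mul_D (hab : a ≤ b) (hm : 0 < m)
    (hw : ∀ j, ContinuousOn (w j) (Icc a b)) (hu : IsSolutionBasis w u) {t : ℝ}
    (ht : t ∈ Icc a b) (j : Fin m) :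
    ∑ i, uStar hm u i t * D j (u i) t = if (j : ℕ) + 1 = m then 1 else 0 := by
  have h := congrFun (congrFun (Matrix.nonsing_inv_mul (W u t)
    ((Matrix.isUnit_iff_isUnit_det _).1 (hu.isUnit_W hab hm hw ht)))
    ⟨m - 1, Nat.sub_lt hm Nat.one_pos⟩) j
  rw [Matrix.mul_apply, Matrix.one_apply] at h
  refine h.trans (if_congr ?_ rfl rfl)
  rw [Fin.ext_iff]
  have := j.2
  simp only
  omega

/-! ### Variation of parameters -/

/-- The function `∑ᵢ (cᵢ + ∫ₐᵗ uᵢ* h) uᵢ(t)`, which solves `L f = h` with initial derivatives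
`∑ᵢ cᵢ uᵢ^{(j)}(a)`. -/
def variation (hm : 0 < m) (u : Fin m → Icc a b → ℝ) (c : Fin m → ℝ) (h : ℝ → ℝ)
    (t : Icc a b) : ℝ :=
  ∑ i, (c i + ∫ v in a..t, uStar hm u i v * h v) * u i t

/-- The `j`-th derivative of `variation hm u c h` for `j < m`: the coefficients are treated as
constants, since the terms with their derivatives cancel. -/
def variationD (hm : 0 < m) (u : Fin m → Icc a b → ℝ) (c : Fin m → ℝ) (h : ℝ → ℝ) (j : ℕ)
    (t : ℝ) : ℝ :=
  ∑ i, (c i + ∫ v in a..t, uStar hm u i v * h v) * D j (u i) t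

section Variation

variable {c : Fin m → ℝ} {h : ℝ → ℝ}

theorem IsSolutionBasis.intervalIntegrable_uStar_mul (hab : a ≤ b) (hm : 0 < m)
    (hw : ∀ j, ContinuousOn (w j) (Icc a b)) (hu : IsSolutionBasis w u)
    (hh : MemLp h 2 (volume.restrict (Icc a b))) (i : Fin m) :
    IntervalIntegrable (fun v => uStar hm u i v * h v) volume a b :=
  (((hu.continuousOn_uStar hab hm hw i).memLp_restrict_Icc 2).integrable_mul
    hh).intervalIntegrable_of_Icc hab

theorem IsSolutionBasis.absolutelyContinuous_coeff (hab : a ≤ b) (hm : 0 < m)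
    (hw : ∀ j, ContinuousOn (w j) (Icc a b)) (hu : IsSolutionBasis w u)
    (hh : MemLp h 2 (volume.restrict (Icc a b))) (i : Fin m) :
    AbsolutelyContinuousOnInterval (fun t => c i + ∫ v in a..t, uStar hm u i v * h v) a b :=
  (LipschitzOnWith.absolutelyContinuousOnInterval
    (K := 0) ((LipschitzWith.const (c i)).lipschitzOnWith (s := uIcc a b))).fun_add
    ((hu.intervalIntegrable_uStar_mul hab hm hw hh i
      ).absolutelyContinuousOnInterval_intervalIntegral left_mem_uIcc)

theorem IsSolutionBasis.absolutelyContinuous_variationD (hab : a ≤ b) (hm : 0 < m)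
    (hw : ∀ j, ContinuousOn (w j) (Icc a b)) (hu : IsSolutionBasis w u)
    (hh : MemLp h 2 (volume.restrict (Icc a b))) {j : ℕ} (hj : j < m) :
    AbsolutelyContinuousOnInterval (variationD hm u c h j) a b :=
  AbsolutelyContinuousOnInterval.fun_sum fun i _ =>
    (hu.absolutelyContinuous_coeff hab hm hw hh i).fun_mul
      (((hu.isSolution i).memSobolev hab hw).absolutelyContinuous j hj)

theorem IsSolutionBasis.continuousOn_variationD (hab : a ≤ b) (hm : 0 < m)
    (hw : ∀ j, ContinuousOn (w j) (Icc a b)) (hu : IsSolutionBasis w u)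
    (hh : MemLp h 2 (volume.restrict (Icc a b))) {j : ℕ} (hj : j ≤ m) :
    ContinuousOn (variationD hm u c h j) (Icc a b) := by
  refine continuousOn_finsetSum _ fun i _ => ContinuousOn.mul ?_
    ((hu.isSolution i).continuousOn_D hw hj)
  simpa only [uIcc_of_le hab] using (hu.absolutelyContinuous_coeff hab hm hw hh i).continuousOn

/-- Differentiating the product produces `∑ᵢ uᵢ* uᵢ^{(j)} h` besides the next `variationD`; this
is zero for `j < m - 1`, and `h` for `j = m - 1`. -/
theorem IsSolutionBasis.derivWithin_variationD_ae (hab : a < b) (hm : 0 < m)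
    (hw : ∀ j, ContinuousOn (w j) (Icc a b)) (hu : IsSolutionBasis w u)
    (hh : MemLp h 2 (volume.restrict (Icc a b))) (j : Fin m) :
    derivWithin (variationD hm u c h j) (Icc a b) =ᵐ[volume.restrict (Icc a b)]
      fun t => (if (j : ℕ) + 1 = m then 1 else 0) * h t + variationD hm u c h (j + 1) t := by
  refine (ae_restrict_iff' measurableSet_Icc).2 ?_
  have H := ae_all_iff.2 fun i =>
    (hu.intervalIntegrable_uStar_mul hab.le hm hw hh i).ae_hasDerivAt_integral
  filter_upwards [H] with t H ht
  rw [← hu.sum_uStar_mul_D hab.le hm hw ht j, variationD, Finset.sum_mul,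
    ← Finset.sum_add_distrib]
  refine HasDerivWithinAt.derivWithin ?_ (uniqueDiffOn_Icc hab t ht)
  refine HasDerivWithinAt.fun_sum fun i _ => ?_
  refine ((((H i (Icc_subset_uIcc ht) a left_mem_uIcc).hasDerivWithinAt).const_add (c i)).mul
    (hasDerivWithinAt_D ((hu.isSolution i).1 j j.2) ht)).congr_deriv ?_
  ring

theorem IsSolutionBasis.hasDerivWithinAt_variationD (hab : a < b) (hm : 0 < m)
    (hw : ∀ j, ContinuousOn (w j) (Icc a b)) (hu : IsSolutionBasis w u)
    (hh : MemLp h 2 (volume.restrict (Icc a b))) {j : ℕ} (hj : j + 1 < m) {x : ℝ}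
    (hx : x ∈ Icc a b) :
    HasDerivWithinAt (variationD hm u c h j) (variationD hm u c h (j + 1) x) (Icc a b) x := by
  have hd : derivWithin (variationD hm u c h j) (Icc a b) =ᵐ[volume.restrict (Icc a b)]
      variationD hm u c h (j + 1) := by
    filter_upwards [hu.derivWithin_variationD_ae (c := c) hab hm hw hh ⟨j, by omega⟩] with t ht
    rw [ht]
    simp [hj.ne]
  have hac := hu.absolutelyContinuous_variationD (c := c) hab.le hm hw hh (j := j) (by omega)
  exact ((hasDerivWithinAt_integral_Icc hab.le
    (hu.continuousOn_variationD (c := c) hab.le hm hw hh hj.le) hx).const_add _).congr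
    (fun y hy => hac.eq_add_integral hab hd hy) (hac.eq_add_integral hab hd hx)

theorem IsSolutionBasis.D_variation (hab : a < b) (hm : 0 < m)
    (hw : ∀ j, ContinuousOn (w j) (Icc a b)) (hu : IsSolutionBasis w u)
    (hh : MemLp h 2 (volume.restrict (Icc a b))) {j : ℕ} (hj : j < m) :
    EqOn (D j (variation hm u c h)) (variationD hm u c h j) (Icc a b) :=
  D_eqOn_of_hasDerivWithinAt (g := variationD hm u c h) (n := m - 1) hab
    (fun x => by simp only [variation, variationD, D_zero_apply])
    (fun _ hk _ hx => hu.hasDerivWithinAt_variationD hab hm hw hh (by omega) hx) (by omega)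

theorem IsSolutionBasis.D_variation_left (hab : a < b) (hm : 0 < m)
    (hw : ∀ j, ContinuousOn (w j) (Icc a b)) (hu : IsSolutionBasis w u)
    (hh : MemLp h 2 (volume.restrict (Icc a b))) {j : ℕ} (hj : j < m) :
    D j (variation hm u c h) a = ∑ i, c i * D j (u i) a := by
  rw [hu.D_variation hab hm hw hh hj (left_mem_Icc.2 hab.le)]
  simp [variationD]

theorem IsSolutionBasis.D_variation_ae (hab : a < b) (hm : 0 < m)
    (hw : ∀ j, ContinuousOn (w j) (Icc a b)) (hu : IsSolutionBasis w u)
    (hh : MemLp h 2 (volume.restrict (Icc a b))) :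
    D m (variation hm u c h) =ᵐ[volume.restrict (Icc a b)] h + variationD hm u c h m := by
  obtain ⟨n, rfl⟩ : ∃ n, m = n + 1 := ⟨m - 1, by omega⟩
  filter_upwards [hu.derivWithin_variationD_ae (c := c) hab hm hw hh ⟨n, n.lt_succ_self⟩,
    ae_restrict_mem measurableSet_Icc] with t h1 ht
  have e := hu.D_variation (c := c) hab hm hw hh n.lt_succ_self
  rw [D_succ, derivWithin_congr e (e ht), h1]
  simp

theorem IsSolutionBasis.memSobolev_variation (hab : a < b) (hm : 0 < m)
    (hw : ∀ j, ContinuousOn (w j) (Icc a b)) (hu : IsSolutionBasis w u)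
    (hh : MemLp h 2 (volume.restrict (Icc a b))) : MemSobolev m (variation hm u c h) where
  differentiableOn j hj := fun x hx =>
    ((hu.hasDerivWithinAt_variationD (c := c) hab hm hw hh hj hx).differentiableWithinAt).congr
      (fun _ hy => hu.D_variation hab hm hw hh (by omega) hy)
      (hu.D_variation hab hm hw hh (by omega) hx)
  absolutelyContinuous j hj :=
    (hu.absolutelyContinuous_variationD hab.le hm hw hh hj).congr_Icc hab.le
      fun _ hx => (hu.D_variation hab hm hw hh hj hx).symm
  memLp := (memLp_congr_ae (hu.D_variation_ae hab hm hw hh)).2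
    (hh.add ((hu.continuousOn_variationD hab.le hm hw hh le_rfl).memLp_restrict_Icc 2))

theorem IsSolutionBasis.L_variation_ae (hab : a < b) (hm : 0 < m)
    (hw : ∀ j, ContinuousOn (w j) (Icc a b)) (hu : IsSolutionBasis w u)
    (hh : MemLp h 2 (volume.restrict (Icc a b))) :
    L w (variation hm u c h) =ᵐ[volume.restrict (Icc a b)] h := by
  filter_upwards [hu.D_variation_ae (c := c) hab hm hw hh,
    ae_restrict_mem measurableSet_Icc] with t h1 ht
  have e : ∀ j : Fin m, D j (variation hm u c h) t = variationD hm u c h j t := fun j =>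
    hu.D_variation hab hm hw hh j.2 ht
  have h0 : variationD hm u c h m t + ∑ j : Fin m, w j t * variationD hm u c h j t = 0 := by
    have : ∀ i, D m (u i) t + ∑ j : Fin m, w j t * D j (u i) t = 0 := fun i =>
      (hu.isSolution i).2 t ht
    simp only [variationD, Finset.mul_sum]
    rw [Finset.sum_comm, ← Finset.sum_add_distrib]
    refine Finset.sum_eq_zero fun i _ => ?_
    rw [← mul_zero (c i + ∫ v in a..t, uStar hm u i v * h v), ← this i, mul_add, Finset.mul_sum]
    congr 1
    exact Finset.sum_congr rfl fun j _ => by ring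
  simp only [L, h1, e, Pi.add_apply]
  rw [add_assoc, h0, add_zero]

/-- Every Sobolev function is given by variation of parameters. -/
theorem IsSolutionBasis.eq_variation (hab : a < b) (hm : 0 < m)
    (hw : ∀ j, ContinuousOn (w j) (Icc a b)) (hu : IsSolutionBasis w u) {f : Icc a b → ℝ}
    (hf : MemSobolev m f) (hc : ∀ j < m, D j f a = ∑ i, c i * D j (u i) a) :
    f = variation hm u c (L w f) := by
  have hL := L_memLp hab.le hw hf
  refine eq_of_D_eq_of_L_ae_eq hab hm hw hf (hu.memSobolev_variation hab hm hw hL)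
    (fun j hj => ?_) (hu.L_variation_ae hab hm hw hL).symm
  rw [hu.D_variation_left hab hm hw hL hj, hc j hj]

/-- The coefficients with prescribed initial derivatives exist because `W(a)` is invertible. -/
theorem IsSolutionBasis.exists_coeff (hab : a ≤ b) (hm : 0 < m)
    (hw : ∀ j, ContinuousOn (w j) (Icc a b)) (hu : IsSolutionBasis w u) (e : ℕ → ℝ) :
    ∃ c : Fin m → ℝ, ∀ j < m, e j = ∑ i, c i * D j (u i) a := by
  refine ⟨Matrix.vecMul (fun j : Fin m => e j) (W u a)⁻¹, fun j hj => ?_⟩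
  have h : Matrix.vecMul (Matrix.vecMul (fun j : Fin m => e j) (W u a)⁻¹) (W u a) =
      fun j : Fin m => e j := by
    rw [Matrix.vecMul_vecMul, Matrix.nonsing_inv_mul _ ((Matrix.isUnit_iff_isUnit_det _).1
      (hu.isUnit_W hab hm hw (left_mem_Icc.2 hab))), Matrix.vecMul_one]
  exact (congrFun h ⟨j, hj⟩).symm

end Variation

/-! ### The Green's function -/

theorem IsSolutionBasis.memLp_G (hab : a ≤ b) (hm : 0 < m)
    (hw : ∀ j, ContinuousOn (w j) (Icc a b)) (hu : IsSolutionBasis w u) (t : Icc a b) :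
    MemLp (G hm u t) 2 (volume.restrict (Icc a b)) := by
  have h : ContinuousOn (fun v => ∑ i, u i t * uStar hm u i v) (Icc a b) :=
    continuousOn_finsetSum _ fun i _ =>
      continuousOn_const.mul (hu.continuousOn_uStar hab hm hw i)
  have e : G hm u t = (Iic (t : ℝ)).indicator fun v => ∑ i, u i t * uStar hm u i v := by
    ext v
    simp [G, indicator_apply]
  rw [e]
  exact (h.memLp_restrict_Icc 2).indicator measurableSet_Iic

/-- Integration against `G` is variation of parameters with zero initial derivatives. -/
theorem IsSolutionBasis.integral_G_mul (hab : a ≤ b) (hm : 0 < m)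
    (hw : ∀ j, ContinuousOn (w j) (Icc a b)) (hu : IsSolutionBasis w u) {h : ℝ → ℝ}
    (hh : MemLp h 2 (volume.restrict (Icc a b))) (t : Icc a b) :
    ∫ v in a..b, G hm u t v * h v = variation hm u 0 h t := by
  have hint : ∀ i, IntervalIntegrable (fun v => uStar hm u i v * h v) volume a t := fun i =>
    (hu.intervalIntegrable_uStar_mul hab hm hw hh i).mono_left_Icc t.2
  have hG : IntervalIntegrable (fun v => G hm u t v * h v) volume a b :=
    ((hu.memLp_G hab hm hw t).integrable_mul hh).intervalIntegrable_of_Icc hab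
  rw [← intervalIntegral.integral_add_adjacent_intervals (hG.mono_left_Icc t.2)
    (hG.mono_set (uIcc_subset_uIcc (Icc_subset_uIcc t.2) right_mem_uIcc))]
  have h1 : ∫ v in a..t, G hm u t v * h v = ∫ v in a..t, ∑ i, u i t * (uStar hm u i v * h v) := by
    refine intervalIntegral.integral_congr fun v hv => ?_
    rw [uIcc_of_le t.2.1] at hv
    simp only [G, hv.2, if_true, Finset.sum_mul, mul_assoc]
  have h2 : ∫ v in (t : ℝ)..b, G hm u t v * h v = 0 := by
    refine intervalIntegral.integral_zero_ae (Filter.Eventually.of_forall fun v hv => ?_)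
    rw [uIoc_of_le t.2.2] at hv
    simp [G, not_le.2 hv.1]
  rw [h1, h2, add_zero, intervalIntegral.integral_finsetSum fun i _ => (hint i).const_mul _]
  simp only [intervalIntegral.integral_const_mul, variation, Pi.zero_apply, zero_add]
  exact Finset.sum_congr rfl fun i _ => mul_comm _ _

theorem IsSolutionBasis.isGreenFunction (hab : a < b) (hm : 0 < m)
    (hw : ∀ j, ContinuousOn (w j) (Icc a b)) (hu : IsSolutionBasis w u) :
    IsGreenFunction w (G hm u) := by
  intro f hf t
  have hL := L_memLp hab.le hw hf.1
  refine ⟨((hu.memLp_G hab.le hm hw t).integrable_mul hL).intervalIntegrable_of_Icc hab.le, ?_⟩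
  rw [hu.integral_G_mul hab.le hm hw hL]
  exact congrFun (hu.eq_variation hab hm hw hf.1 fun j hj => by simp [hf.2 j hj]) t

/-- The section `R₁(·, t)` is the solution of `L f = G(t, ·)` with zero initial derivatives. -/
theorem IsSolutionBasis.R₁_eq_variation (hab : a ≤ b) (hm : 0 < m)
    (hw : ∀ j, ContinuousOn (w j) (Icc a b)) (hu : IsSolutionBasis w u) (t : Icc a b) :
    (fun s => R₁ hm u s t) = variation hm u 0 (G hm u t) :=
  funext fun s => hu.integral_G_mul hab hm hw (hu.memLp_G hab hm hw t) s

theorem IsSolutionBasis.R₁_mem_H₁ (hab : a < b) (hm : 0 < m)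
    (hw : ∀ j, ContinuousOn (w j) (Icc a b)) (hu : IsSolutionBasis w u) (t : Icc a b) :
    (fun s => R₁ hm u s t) ∈ H₁ a b m := by
  rw [hu.R₁_eq_variation hab.le hm hw]
  refine ⟨hu.memSobolev_variation hab hm hw (hu.memLp_G hab.le hm hw t), fun j hj => ?_⟩
  rw [hu.D_variation_left hab hm hw (hu.memLp_G hab.le hm hw t) hj]
  simp

/-! ### A criterion for reproducing kernel Hilbert spaces -/

/-- A space of functions that is linearly isometric to a Hilbert space, and on which evaluation at
`t` is represented by `R(·, t)`, has reproducing kernel `R`. -/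
theorem hasKernel_of_linearIsometryEquiv {X E F : Type*} [NormedAddCommGroup E]
    [InnerProductSpace ℝ E] [CompleteSpace E] [NormedAddCommGroup F] [InnerProductSpace ℝ F]
    (ι : F →ₗ[ℝ] X → ℝ) (hι : Function.Injective ι) (R : X → X → ℝ) (Φ : F ≃ₗᵢ[ℝ] E) (r : X → F)
    (hr : ∀ t s, ι (r t) s = R s t) (hrep : ∀ t f, inner ℝ (r t) f = ι f t) :
    HasKernel ι R := by
  have hcomp : CompleteSpace F := Φ.toIsometryEquiv.completeSpace_iff.2 inferInstance
  let hRK : RKHS ℝ F X ℝ :=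
    { coeCLM :=
        { toLinearMap := ι
          cont := continuous_pi fun t => by
            have : Continuous fun f : F => inner ℝ (r t) f := by fun_prop
            simp only [hrep] at this
            exact this }
      coeCLM_injective := hι }
  refine ⟨hcomp, hRK, fun f => rfl, fun s t => ?_, fun t => ⟨r t, hr t, hrep t⟩⟩
  have hk : RKHS.kerFun F t (1 : ℝ) = r t := by
    refine ext_inner_right ℝ fun f => ?_
    rw [RKHS.kerFun_inner, hrep]
    simp only [RCLike.inner_apply, map_one, mul_one]
    rfl
  rw [← RKHS.kerFun_apply, hk]
  exact hr t s

/-- The same criterion for a submodule of functions with a bilinear form that is transported from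
a Hilbert space. -/
theorem isRKHSWith_of_linearEquiv {X E : Type*} [NormedAddCommGroup E] [InnerProductSpace ℝ E]
    [CompleteSpace E] (H : Submodule ℝ (X → ℝ)) (B : (X → ℝ) → (X → ℝ) → ℝ) (R : X → X → ℝ)
    (Φ : H ≃ₗ[ℝ] E) (hB : ∀ f g : H, B f g = inner ℝ (Φ f) (Φ g))
    (hR : ∀ t, (fun s => R s t) ∈ H) (hrep : ∀ t, ∀ f : H, B (fun s => R s t) f = (f : X → ℝ) t) :
    IsRKHSWith H B R := by
  let core : InnerProductSpace.Core ℝ H :=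
    { inner := fun f g => inner ℝ (Φ f) (Φ g)
      conj_inner_symm := fun f g => inner_conj_symm _ _
      re_inner_nonneg := fun f => real_inner_self_nonneg
      add_left := fun f g h => by rw [map_add, inner_add_left]
      smul_left := fun f g r => by rw [map_smul, inner_smul_left]
      definite := fun f hf => Φ.map_eq_zero_iff.1 (inner_self_eq_zero.1 hf) }
  refine ⟨core, fun f g => (hB f g).symm, ?_⟩
  let : NormedAddCommGroup H := core.toNormedAddCommGroup
  let : InnerProductSpace ℝ H := InnerProductSpace.ofCore core.toCore
  have hinner : ∀ f g : H, inner ℝ f g = inner ℝ (Φ f) (Φ g) := fun _ _ => rfl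
  have hnorm : ∀ f : H, ‖Φ f‖ = ‖f‖ := fun f => by
    rw [norm_eq_sqrt_real_inner, norm_eq_sqrt_real_inner, hinner]
  exact hasKernel_of_linearIsometryEquiv H.subtype Subtype.val_injective R
    { Φ with norm_map' := hnorm } (fun t => ⟨fun s => R s t, hR t⟩) (fun _ _ => rfl)
    fun t f => (hB ⟨_, hR t⟩ f).symm.trans (hrep t f)

/-! ### The inner product and the orthogonal decomposition -/

/-- The initial derivatives `(f(a), f'(a), …, f^{(m-1)}(a))`. -/
def jet (a b : ℝ) (m : ℕ) : Sob a b m →ₗ[ℝ] EuclideanSpace ℝ (Fin m) where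
  toFun f := WithLp.toLp 2 fun j => D j (f : Icc a b → ℝ) a
  map_add' f g := by
    ext j
    simpa using congrFun (D_lin_of_lt f.2 g.2 1 1 j (Or.inl j.2)) a
  map_smul' c f := by
    ext j
    simpa using congrFun (D_lin_of_lt f.2 f.2 c 0 j (Or.inl j.2)) a

/-- The class of `L f` in `L²[a, b]`. -/
def lpL (hab : a ≤ b) (hw : ∀ j, ContinuousOn (w j) (Icc a b)) :
    Sob a b m →ₗ[ℝ] Lp ℝ 2 (volume.restrict (Icc a b)) where
  toFun f := (L_memLp hab hw f.2).toLp
  map_add' f g := by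
    rw [← MemLp.toLp_add, MemLp.toLp_eq_toLp_iff]
    simpa using L_lin_ae w f.2 g.2 1 1
  map_smul' c f := by
    rw [RingHom.id_apply, ← MemLp.toLp_const_smul, MemLp.toLp_eq_toLp_iff]
    simpa using L_lin_ae w f.2 f.2 c 0

theorem ip_eq_inner (hab : a ≤ b) (hw : ∀ j, ContinuousOn (w j) (Icc a b)) (f g : Sob a b m) :
    ip w (f : Icc a b → ℝ) (g : Icc a b → ℝ) =
      inner ℝ (jet a b m f) (jet a b m g) + inner ℝ (lpL hab hw f) (lpL hab hw g) := by
  rw [ip, L2.inner_def, intervalIntegral_eq_setIntegral_Icc hab]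
  congr 1
  · simp [jet, PiLp.inner_apply, mul_comm]
  · refine integral_congr_ae ?_
    filter_upwards [(L_memLp hab hw f.2).coeFn_toLp, (L_memLp hab hw g.2).coeFn_toLp]
      with t h1 h2
    simp only [lpL, LinearMap.coe_mk, AddHom.coe_mk, h1, h2]
    simp [mul_comm]

theorem eq_of_jet_eq_of_lpL_eq (hab : a < b) (hm : 0 < m)
    (hw : ∀ j, ContinuousOn (w j) (Icc a b)) {f g : Sob a b m}
    (hj : jet a b m f = jet a b m g) (hL : lpL hab.le hw f = lpL hab.le hw g) : f = g :=
  Subtype.ext <| eq_of_D_eq_of_L_ae_eq hab hm hw f.2 g.2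
    (fun j hjm => congrArg (fun e : EuclideanSpace ℝ (Fin m) => e ⟨j, hjm⟩) hj)
    ((MemLp.toLp_eq_toLp_iff (L_memLp hab.le hw f.2) (L_memLp hab.le hw g.2)).1 hL)

theorem IsSolutionBasis.exists_jet_lpL (hab : a < b) (hm : 0 < m)
    (hw : ∀ j, ContinuousOn (w j) (Icc a b)) (hu : IsSolutionBasis w u)
    (e : EuclideanSpace ℝ (Fin m)) (h : Lp ℝ 2 (volume.restrict (Icc a b))) :
    ∃ f : Sob a b m, jet a b m f = e ∧ lpL hab.le hw f = h := by
  obtain ⟨c, hc⟩ := hu.exists_coeff hab.le hm hw fun j => if hj : j < m then e ⟨j, hj⟩ else 0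
  refine ⟨⟨variation hm u c h, hu.memSobolev_variation hab hm hw (Lp.memLp h)⟩, ?_, ?_⟩
  · ext j
    have := hc j j.2
    simp only [j.2, dite_true] at this
    exact (hu.D_variation_left hab hm hw (Lp.memLp h) j.2).trans this.symm
  · refine Lp.ext ?_
    have hs := hu.memSobolev_variation (c := c) hab hm hw (Lp.memLp h)
    exact (MemLp.coeFn_toLp (L_memLp hab.le hw hs)).trans (hu.L_variation_ae hab hm hw (Lp.memLp h))

theorem H₀_le_Sob : H₀ (a := a) (b := b) w ≤ Sob a b m := fun _ hf => hf.1

theorem H₁_le_Sob : H₁ a b m ≤ Sob a b m := fun _ hf => hf.1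

theorem ip_of_mem_H₀ (hab : a ≤ b) {f : Icc a b → ℝ} (hf : f ∈ H₀ w) (g : Icc a b → ℝ) :
    ip w f g = ∑ j : Fin m, D j f a * D j g a := by
  rw [ip, intervalIntegral_eq_setIntegral_Icc hab, integral_eq_zero_of_ae, add_zero]
  filter_upwards [hf.2] with t ht
  simp [ht]

theorem ip_of_mem_H₁ {f : Icc a b → ℝ} (hf : f ∈ H₁ a b m) (g : Icc a b → ℝ) :
    ip w f g = ∫ t in a..b, L w f t * L w g t := by
  rw [ip, Finset.sum_eq_zero fun j _ => by rw [hf.2 j j.2, zero_mul], zero_add]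

theorem IsSolutionBasis.H₀_eq_span (hab : a < b) (hm : 0 < m)
    (hw : ∀ j, ContinuousOn (w j) (Icc a b)) (hu : IsSolutionBasis w u) :
    H₀ w = Submodule.span ℝ (range u) := by
  refine SetLike.ext' ?_
  rw [hu.2]
  exact Set.ext fun f => mem_H₀_iff_isSolution hab hm hw

/-- There is a solution with prescribed initial derivatives. -/
theorem IsSolutionBasis.exists_mem_H₀ (hab : a < b) (hm : 0 < m)
    (hw : ∀ j, ContinuousOn (w j) (Icc a b)) (hu : IsSolutionBasis w u) (e : ℕ → ℝ) :
    ∃ g ∈ H₀ (a := a) (b := b) w, ∀ j < m, D j g a = e j := by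
  obtain ⟨c, hc⟩ := hu.exists_coeff hab.le hm hw e
  refine ⟨_, (mem_H₀_iff_isSolution hab hm hw).2 (hu.isSolution_sum c), fun j hj => ?_⟩
  rw [D_lin_sum_of_lt _ (fun i => (hu.isSolution i).memSobolev hab.le hw) c hj, hc j hj]

theorem IsSolutionBasis.H₀_sup_H₁ (hab : a < b) (hm : 0 < m)
    (hw : ∀ j, ContinuousOn (w j) (Icc a b)) (hu : IsSolutionBasis w u) :
    H₀ w ⊔ H₁ a b m = Sob a b m := by
  refine le_antisymm (sup_le H₀_le_Sob H₁_le_Sob) fun f hf => ?_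
  obtain ⟨g, hg, hgD⟩ := hu.exists_mem_H₀ hab hm hw fun j => D j f a
  refine Submodule.mem_sup.2 ⟨g, hg, f - g, ⟨(Sob a b m).sub_mem hf hg.1, fun j hj => ?_⟩, by simp⟩
  have h := congrFun (D_lin_of_lt hf hg.1 1 (-1) j (Or.inl hj)) a
  simpa [← sub_eq_add_neg, hgD j hj] using h

theorem disjoint_H₀_H₁ (hab : a < b) (hm : 0 < m) (hw : ∀ j, ContinuousOn (w j) (Icc a b)) :
    Disjoint (H₀ w) (H₁ a b m) :=
  Submodule.disjoint_def.2 fun _ h0 h1 =>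
    ((mem_H₀_iff_isSolution hab hm hw).1 h0).eq_zero hm hw (left_mem_Icc.2 hab.le) h1.2

theorem IsSolutionBasis.mem_H₁_iff_orthogonal (hab : a < b) (hm : 0 < m)
    (hw : ∀ j, ContinuousOn (w j) (Icc a b)) (hu : IsSolutionBasis w u) (f : Icc a b → ℝ) :
    f ∈ H₁ a b m ↔ f ∈ Sob a b m ∧ ∀ g ∈ H₀ w, ip w g f = 0 := by
  refine ⟨fun hf => ⟨hf.1, fun g hg => ?_⟩, fun hf => ⟨hf.1, fun j hj => ?_⟩⟩
  · rw [ip_of_mem_H₀ hab.le hg]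
    exact Finset.sum_eq_zero fun j _ => by rw [hf.2 j j.2, mul_zero]
  · obtain ⟨g, hg, hgD⟩ := hu.exists_mem_H₀ hab hm hw fun j => D j f a
    have h := hf.2 g hg
    rw [ip_of_mem_H₀ hab.le hg, Finset.sum_congr rfl fun j _ => by rw [hgD j j.2],
      Finset.sum_eq_zero_iff_of_nonneg fun j _ => mul_self_nonneg _] at h
    exact mul_self_eq_zero.1 (h ⟨j, hj⟩ (Finset.mem_univ _))

/-! ### The reproducing kernels -/

theorem R₀_eq_sum_smul (t : Icc a b) :
    (fun s => R₀ u s t) =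
      ∑ i, (∑ j, (W u a * (W u a).transpose)⁻¹ i j * u j t) • u i := by
  ext s
  simp only [R₀, Finset.sum_apply, Pi.smul_apply, smul_eq_mul, Finset.sum_mul]
  exact Finset.sum_congr rfl fun i _ => Finset.sum_congr rfl fun j _ => by ring

theorem IsSolutionBasis.R₀_mem_H₀ (hab : a < b) (hm : 0 < m)
    (hw : ∀ j, ContinuousOn (w j) (Icc a b)) (hu : IsSolutionBasis w u) (t : Icc a b) :
    (fun s => R₀ u s t) ∈ H₀ w := by
  rw [R₀_eq_sum_smul]
  exact (mem_H₀_iff_isSolution hab hm hw).2 (hu.isSolution_sum _)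

/-- Pairing the initial derivatives with those of `R₀(·, t)` evaluates the solution
`∑ᵢ cᵢ uᵢ` at `t`: with `W = W(a)`, this is `W Wᵀ (W Wᵀ)⁻¹ = 1`. -/
theorem IsSolutionBasis.sum_D_R₀_mul (hab : a < b) (hm : 0 < m)
    (hw : ∀ j, ContinuousOn (w j) (Icc a b)) (hu : IsSolutionBasis w u) (t : Icc a b)
    (c : Fin m → ℝ) :
    ∑ j : Fin m, D j (fun s => R₀ u s t) a * ∑ i, c i * D j (u i) a = ∑ i, c i * u i t := by
  set A := W u a with hA
  set C := (A * A.transpose)⁻¹ with hC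
  have hdet : IsUnit (A * A.transpose).det := by
    have h := (Matrix.isUnit_iff_isUnit_det _).1 (hu.isUnit_W hab.le hm hw (left_mem_Icc.2 hab.le))
    rw [Matrix.det_mul, Matrix.det_transpose]
    exact h.mul h
  have hD : ∀ j : Fin m, D j (fun s => R₀ u s t) a =
      Matrix.mulVec A.transpose (Matrix.mulVec C fun i => u i t) j := by
    intro j
    rw [R₀_eq_sum_smul, D_lin_sum_of_lt _ (fun i => (hu.isSolution i).memSobolev hab.le hw) _ j.2]
    exact Finset.sum_congr rfl fun i _ => mul_comm _ _
  have hc : ∀ j : Fin m, ∑ i, c i * D j (u i) a = Matrix.vecMul c A j := fun j => rfl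
  simp only [hD, hc]
  have h1 : ∑ j, Matrix.mulVec A.transpose (Matrix.mulVec C fun i => u i t) j *
      Matrix.vecMul c A j = dotProduct (Matrix.vecMul c A)
        (Matrix.mulVec A.transpose (Matrix.mulVec C fun i => u i t)) :=
    Finset.sum_congr rfl fun j _ => mul_comm _ _
  rw [h1, ← Matrix.dotProduct_mulVec, Matrix.mulVec_mulVec, Matrix.mulVec_mulVec,
    Matrix.mul_nonsing_inv _ hdet, Matrix.one_mulVec]
  rfl

/-- The two terms of variation of parameters, as pairings with `R₀(·, t)` and `G(t, ·)`. -/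
theorem IsSolutionBasis.sum_add_integral_eq (hab : a < b) (hm : 0 < m)
    (hw : ∀ j, ContinuousOn (w j) (Icc a b)) (hu : IsSolutionBasis w u) {f : Icc a b → ℝ}
    (hf : MemSobolev m f) (t : Icc a b) :
    ∑ j : Fin m, D j (fun s => R₀ u s t) a * D j f a + ∫ v in a..b, G hm u t v * L w f v =
      f t := by
  obtain ⟨c, hc⟩ := hu.exists_coeff hab.le hm hw fun j => D j f a
  rw [hu.integral_G_mul hab.le hm hw (L_memLp hab.le hw hf), Finset.sum_congr rfl fun j _ => by
    rw [hc j j.2], hu.sum_D_R₀_mul hab hm hw t c]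
  refine Eq.trans ?_ (congrFun (hu.eq_variation hab hm hw hf hc) t).symm
  simp only [variation, Pi.zero_apply, zero_add, ← Finset.sum_add_distrib, add_mul]

theorem IsSolutionBasis.L_R₁_ae (hab : a < b) (hm : 0 < m)
    (hw : ∀ j, ContinuousOn (w j) (Icc a b)) (hu : IsSolutionBasis w u) (t : Icc a b) :
    L w (fun s => R₁ hm u s t) =ᵐ[volume.restrict (Icc a b)] G hm u t := by
  rw [hu.R₁_eq_variation hab.le hm hw]
  exact hu.L_variation_ae hab hm hw (hu.memLp_G hab.le hm hw t)

theorem intervalIntegral_mul_congr_left (hab : a ≤ b) {f g : ℝ → ℝ}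
    (h : f =ᵐ[volume.restrict (Icc a b)] g) (k : ℝ → ℝ) :
    ∫ t in a..b, f t * k t = ∫ t in a..b, g t * k t := by
  rw [intervalIntegral_eq_setIntegral_Icc hab, intervalIntegral_eq_setIntegral_Icc hab]
  refine integral_congr_ae ?_
  filter_upwards [h] with t ht
  rw [ht]

theorem IsSolutionBasis.isRKHSWith_Sob (hab : a < b) (hm : 0 < m)
    (hw : ∀ j, ContinuousOn (w j) (Icc a b)) (hu : IsSolutionBasis w u) :
    IsRKHSWith (Sob a b m) (ip w) (fun s t => R₀ u s t + R₁ hm u s t) := by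
  let Φ : Sob a b m →ₗ[ℝ]
      WithLp 2 (EuclideanSpace ℝ (Fin m) × Lp ℝ 2 (volume.restrict (Icc a b))) :=
    (WithLp.linearEquiv 2 ℝ _).symm.toLinearMap ∘ₗ (jet a b m).prod (lpL hab.le hw)
  have hΦ : Function.Bijective Φ := by
    refine ⟨fun f g h => ?_, fun y => ?_⟩
    · exact eq_of_jet_eq_of_lpL_eq hab hm hw (congrArg WithLp.fst h) (congrArg WithLp.snd h)
    · obtain ⟨f, h1, h2⟩ := hu.exists_jet_lpL hab hm hw y.fst y.snd
      exact ⟨f, WithLp.ofLp_injective 2 (Prod.ext h1 h2)⟩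
  have h0 := hu.R₀_mem_H₀ hab hm hw
  have h1 := hu.R₁_mem_H₁ hab hm hw
  refine isRKHSWith_of_linearEquiv _ _ _ (LinearEquiv.ofBijective Φ hΦ)
    (fun f g => ip_eq_inner hab.le hw f g)
    (fun t => (Sob a b m).add_mem (h0 t).1 (h1 t).1) fun t f => ?_
  rw [← hu.sum_add_integral_eq hab hm hw f.2 t, ip]
  have e : (fun s => R₀ u s t + R₁ hm u s t) =
      (1 : ℝ) • (fun s => R₀ u s t) + (1 : ℝ) • (fun s => R₁ hm u s t) := by
    ext s
    simp
  congr 1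
  · refine Finset.sum_congr rfl fun j _ => ?_
    rw [e, D_lin_of_lt (h0 t).1 (h1 t).1 1 1 j (Or.inl j.2)]
    simp [(h1 t).2 j j.2]
  · refine intervalIntegral_mul_congr_left hab.le ?_ _
    rw [e]
    filter_upwards [L_lin_ae w (h0 t).1 (h1 t).1 1 1, (h0 t).2, hu.L_R₁_ae hab hm hw t]
      with v hv hv0 hv1
    rw [hv]
    simp [hv0, hv1]

theorem IsSolutionBasis.isRKHSWith_H₀ (hab : a < b) (hm : 0 < m)
    (hw : ∀ j, ContinuousOn (w j) (Icc a b)) (hu : IsSolutionBasis w u) :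
    IsRKHSWith (H₀ w) (ip w) (R₀ u) := by
  let Φ := jet a b m ∘ₗ Submodule.inclusion (H₀_le_Sob (w := w))
  have hL : ∀ f : H₀ (a := a) (b := b) w, lpL hab.le hw ⟨f, f.2.1⟩ = 0 := fun f =>
    Lp.ext ((MemLp.coeFn_toLp (L_memLp hab.le hw f.2.1)).trans
      (Filter.EventuallyEq.trans f.2.2 (Lp.coeFn_zero ℝ 2 _).symm))
  have hΦ : Function.Bijective Φ := by
    refine ⟨fun f g h => ?_, fun e => ?_⟩
    · have := eq_of_jet_eq_of_lpL_eq hab hm hw (f := ⟨f, f.2.1⟩) (g := ⟨g, g.2.1⟩) h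
        ((hL f).trans (hL g).symm)
      exact Subtype.ext (Subtype.mk.inj this)
    · obtain ⟨f, h1, h2⟩ := hu.exists_jet_lpL hab hm hw e 0
      refine ⟨⟨f, f.2, ?_⟩, h1⟩
      have h2 : (L_memLp hab.le hw f.2).toLp = 0 := h2
      have h3 := (L_memLp hab.le hw f.2).coeFn_toLp
      rw [h2] at h3
      exact h3.symm.trans (Lp.coeFn_zero ℝ 2 _)
  refine isRKHSWith_of_linearEquiv _ _ _ (LinearEquiv.ofBijective Φ hΦ) (fun f g => ?_)
    (hu.R₀_mem_H₀ hab hm hw) fun t f => ?_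
  · refine (ip_eq_inner hab.le hw ⟨f, f.2.1⟩ ⟨g, g.2.1⟩).trans ?_
    rw [hL f, inner_zero_left, add_zero]
    rfl
  · have h : ∫ v in a..b, G hm u t v * L w (f : Icc a b → ℝ) v = 0 := by
      rw [intervalIntegral_eq_setIntegral_Icc hab.le]
      refine integral_eq_zero_of_ae ?_
      filter_upwards [f.2.2] with v hv
      simp [hv]
    rw [← hu.sum_add_integral_eq hab hm hw f.2.1 t, h, add_zero]
    exact ip_of_mem_H₀ hab.le (hu.R₀_mem_H₀ hab hm hw t) f

theorem IsSolutionBasis.isRKHSWith_H₁ (hab : a < b) (hm : 0 < m)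
    (hw : ∀ j, ContinuousOn (w j) (Icc a b)) (hu : IsSolutionBasis w u) :
    IsRKHSWith (H₁ a b m) (ip w) (R₁ hm u) := by
  let Φ := lpL hab.le hw ∘ₗ Submodule.inclusion (H₁_le_Sob (a := a) (b := b) (m := m))
  have hj : ∀ f : H₁ a b m, jet a b m ⟨f, f.2.1⟩ = 0 := fun f => by
    ext j
    exact f.2.2 j j.2
  have hΦ : Function.Bijective Φ := by
    refine ⟨fun f g h => ?_, fun h => ?_⟩
    · have := eq_of_jet_eq_of_lpL_eq hab hm hw (f := ⟨f, f.2.1⟩) (g := ⟨g, g.2.1⟩)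
        ((hj f).trans (hj g).symm) h
      exact Subtype.ext (Subtype.mk.inj this)
    · obtain ⟨f, h1, h2⟩ := hu.exists_jet_lpL hab hm hw 0 h
      exact ⟨⟨f, f.2, fun j hjm =>
        congrArg (fun e : EuclideanSpace ℝ (Fin m) => e ⟨j, hjm⟩) h1⟩, h2⟩
  refine isRKHSWith_of_linearEquiv _ _ _ (LinearEquiv.ofBijective Φ hΦ) (fun f g => ?_)
    (hu.R₁_mem_H₁ hab hm hw) fun t f => ?_
  · refine (ip_eq_inner hab.le hw ⟨f, f.2.1⟩ ⟨g, g.2.1⟩).trans ?_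
    rw [hj f, inner_zero_left, zero_add]
    rfl
  · rw [ip_of_mem_H₁ (hu.R₁_mem_H₁ hab hm hw t),
      intervalIntegral_mul_congr_left hab.le (hu.L_R₁_ae hab hm hw t)]
    exact (hu.isGreenFunction hab hm hw f f.2 t).2.symm

end GreenRKHS

end

theorem mainTheorem2 {a b : ℝ} (hab : a < b) {m : ℕ} (hm : 0 < m)
    (w : Fin m → ℝ → ℝ) (hw : ∀ j, ContinuousOn (w j) (Icc a b))
    (u : Fin m → Icc a b → ℝ) (hu : IsSolutionBasis w u) :
    -- the objects in the statement are well defined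
    (∀ f ∈ Sob a b m, MemLp (L w f) 2 (volume.restrict (Icc a b))) ∧
    (∀ t ∈ Icc a b, IsUnit (W u t)) ∧
    (∀ t, MemLp (G hm u t) 2 (volume.restrict (Icc a b))) ∧
    IsGreenFunction w (G hm u) ∧
    -- the reproducing kernel of the whole space
    IsRKHSWith (Sob a b m) (ip w) (fun s t => R₀ u s t + R₁ hm u s t) ∧
    -- the orthogonal decomposition
    H₀ w = Submodule.span ℝ (range u) ∧
    H₀ w ⊔ H₁ a b m = Sob a b m ∧
    Disjoint (H₀ w) (H₁ a b m) ∧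
    (∀ f, f ∈ H₁ a b m ↔ f ∈ Sob a b m ∧ ∀ g ∈ H₀ w, ip w g f = 0) ∧
    -- the reproducing kernels of the two summands
    IsRKHSWith (H₀ w) (ip w) (R₀ u) ∧
    IsRKHSWith (H₁ a b m) (ip w) (R₁ hm u) :=
  ⟨fun _ hf => L_memLp hab.le hw hf, fun _ ht => hu.isUnit_W hab.le hm hw ht,
    hu.memLp_G hab.le hm hw, hu.isGreenFunction hab hm hw, hu.isRKHSWith_Sob hab hm hw,
    hu.H₀_eq_span hab hm hw, hu.H₀_sup_H₁ hab hm hw, disjoint_H₀_H₁ hab hm hw,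
    hu.mem_H₁_iff_orthogonal hab hm hw, hu.isRKHSWith_H₀ hab hm hw, hu.isRKHSWith_H₁ hab hm hw⟩
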